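/- Let $m\ge 3$ and let $U\subset\mathbb R^m$ be a nonempty connected open set. Let $u,v\in C^2(U)$ be real valued and let $\vec F$ be a $C^1$ vector field on $U$ such that $\nabla u+\vec F\ne 0$ and $\nabla v+\vec F\neq 0$ at every point of $U$. For $w\in\{u,v\}$ put $$N_{\vec F}(w)=\frac{\nabla w+\vec F}{|\nabla w+\vec F|},\qquad H_{\vec F}(w)=\operatorname{div}N_{\vec F}(w).$$ For $C^1$ vector fields $X_1,\dots,X_r$ on $U$ let $\mathcal L(X_1,\dots,X_r)$ be the smallest $C^\infty(U)$-module of vector fields on $U$ that contains $X_1,\dots,X_r$ and contains $[Z,W]$ whenever it contains $Z$ and $W$ and both are of class $C^1$ (if the $X_i$ are $C^\infty$, this is the smallest $C^\infty(U)$-module that contains them and is closed under the Lie bracket). Its rank at $q\in U$ is the dimension of the linear span of all vectors $Z(q)$, $Z\in\mathcal L(X_1,\dots,X_r)$. Suppose that $H_{\vec F}(v)\le H_{\vec F}(u)$ and $v\ge u$ in $U$, and that $v(p_0)=u(p_0)$ for some $p_0\in U$. Suppose that, for $w=u$ or for $w=v$, there are $C^1$ vector fields $N_1^\perp,\dots,N_{m-1}^\perp$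 on $U$ which at every point $x$ of $U$ form an orthonormal basis of the orthogonal complement of $N_{\vec F}(w)(x)$, and such that $\mathcal L(N_1^\perp,\dots,N_{m-1}^\perp)$ has rank $m$ at every point of $U$. Then $v\equiv u$ in $U$. -/

import Mathlib

open scoped ContDiff

noncomputable section

namespace HorizontalCurvature

/-- The Euclidean space of dimension `m`. -/
abbrev E (m : ℕ) : Type := EuclideanSpace ℝ (Fin m)

/-- The divergence of a vector field on Euclidean space at `x`: the sum of the `∂ᵢ Wⁱ (x)`. -/
def divergence {m : ℕ} (W : E m → E m) (x : E m) : ℝ :=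
  ∑ i : Fin m, (fderiv ℝ W x (EuclideanSpace.single i 1)) i

/-- The point `x` is nonsingular for `u`: `∇u + F ≠ 0` at `x`. -/
def Nonsingular {m : ℕ} (F : E m → E m) (u : E m → ℝ) (x : E m) : Prop :=
  gradient u x + F x ≠ 0

/-- The horizontal normal `N_F(u) = (∇u + F) / |∇u + F|`. -/
def horizontalNormal {m : ℕ} (F : E m → E m) (u : E m → ℝ) (x : E m) : E m :=
  ‖gradient u x + F x‖⁻¹ • (gradient u x + F x)

/-- The horizontal mean curvature `H_F(u) = div N_F(u)`. -/
def horizontalMeanCurvature {m : ℕ} (F : E m → E m) (u : E m → ℝ) (x : E m) : ℝ :=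
  divergence (horizontalNormal F u) x

/-- Membership in the Lie span of the vector fields `X i` on the open set `U`: the smallest
module over the smooth functions on `U` that contains the `X i` and is closed under the Lie
bracket. The bracket of two members is taken whenever both are of class `C^1` on `U`; if the
`X i` are smooth on `U`, then all members are, and this is no restriction. Only the values on
`U` matter. -/
inductive LieSpan {m : ℕ} {ι : Type} (U : Set (E m)) (X : ι → E m → E m) :
    (E m → E m) → Prop
  | gen (i : ι) : LieSpan U X (X i)
  | zero : LieSpan U X 0
  | add {Z W : E m → E m} : LieSpan U X Z → LieSpan U X W → LieSpan U X (Z + W)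
  | smul {c : E m → ℝ} {Z : E m → E m} :
      ContDiffOn ℝ ∞ c U → LieSpan U X Z → LieSpan U X (fun x => c x • Z x)
  | bracket {Z W : E m → E m} :
      ContDiffOn ℝ 1 Z U → ContDiffOn ℝ 1 W U → LieSpan U X Z → LieSpan U X W →
      LieSpan U X (VectorField.lieBracket ℝ Z W)

/-- The rank of the Lie span at `q`: the dimension of the space of all values `Z q` of its
members `Z`. -/
def lieRank {m : ℕ} {ι : Type} (U : Set (E m)) (X : ι → E m → E m) (q : E m) : ℕ :=
  Module.finrank ℝ (Submodule.span ℝ {z : E m | ∃ Z : E m → E m, LieSpan U X Z ∧ Z q = z})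

/-- The `X α` form a `C^1` orthonormal frame on `U` of the hyperplane field perpendicular to
the vector field `N`. -/
def IsOrthonormalFramePerp {m : ℕ} (U : Set (E m)) (N : E m → E m)
    (X : Fin (m - 1) → E m → E m) : Prop :=
  (∀ α, ContDiffOn ℝ 1 (X α) U) ∧
  ∀ x ∈ U, Orthonormal ℝ (fun α => X α x) ∧
    Submodule.span ℝ (Set.range fun α => X α x) = (Submodule.span ℝ {N x})ᗮ

/-- On `U` there is an orthonormal frame of the hyperplane field perpendicular to `N_F(u)`
whose Lie span has constant rank `m`. -/
def HasFullRankNormalFrame {m : ℕ} (U : Set (E m)) (F : E m → E m) (u : E m → ℝ) : Prop :=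
  ∃ X : Fin (m - 1) → E m → E m,
    IsOrthonormalFramePerp U (horizontalNormal F u) X ∧ ∀ q ∈ U, lieRank U X q = m

end HorizontalCurvature

end

/-! This is Bony's strong maximum principle for the difference `φ = v - u ≥ 0`, whose zero set in
`U` is the trace of a closed set `C`. At a zero of `φ` the gradients of `u` and `v` agree. Near it
the trace of the Hessian of `φ` over the hyperplane perpendicular to `N_F(w)` is, up to a positive
factor, the divergence expression linearised in the second derivatives, and `F` drops out. The
curvature inequality therefore gives `∑ D²φ(Xᵢ, Xᵢ) ≤ K |∇φ|` (`exists_sum_hessian_le`).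

This inequality is degenerate elliptic, so Hopf's barrier argument works only in the directions
`Xᵢ`. It shows that every `Xᵢ` is perpendicular to the proximal normals of `C`
(`isTangentTo_zeroSet`).

Tangency passes to brackets. Integral curves of a tangent `C^1` field that start in `C` stay in `C`
for a short time (`IsTangentTo.integralCurve_mem`), so the commutator of two flows traces an arc in
`C` with leading term `s² [X, Y]`, and such an arc cannot enter a ball disjoint from `C`
(`IsTangentTo.lieBracket`). Full rank then leaves no nonzero proximal normal. Hence `C` is a
neighbourhood of each of its points in `U`, and connectedness gives `U ⊆ C`
(`subset_of_isTangentTo_of_lieRank`). -/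

namespace HorizontalCurvature

/-! ### Fields tangent to a closed set: invariance under flows and brackets. -/

section Tangency

open Metric Set Filter Topology Asymptotics
open scoped NNReal

variable {V : Type*} [NormedAddCommGroup V] [InnerProductSpace ℝ V]

/-- The field `X` is tangent to `C` within `U`: it is perpendicular to every proximal normal of `C`
that is realised by a ball whose closure lies in `U`. -/
def IsTangentTo (U C : Set V) (X : V → V) : Prop :=
  ∀ z ∈ C, ∀ y, closedBall y (dist z y) ⊆ U → Disjoint (ball y (dist z y)) C →
    inner ℝ (X z) (y - z) = 0

/-- The foot is no farther from `y` than `x₀` is. The factor 2 thus keeps the foot and the whole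
touching ball inside `closedBall x₀ ρ`, where tangency can be applied. -/
theorem exists_foot {α : Type*} [PseudoMetricSpace α] [ProperSpace α] {U C : Set α}
    (hC : IsClosed C) {x₀ : α} {ρ : ℝ} (hx₀ : x₀ ∈ C) (hU : closedBall x₀ ρ ⊆ U) {y : α} (hy : 2 * dist y x₀ ≤ ρ) :
    ∃ z ∈ C, infDist y C = dist y z ∧ z ∈ closedBall x₀ ρ ∧
      closedBall y (dist z y) ⊆ U ∧ Disjoint (ball y (dist z y)) C := by
  obtain ⟨z, hz, hd⟩ := hC.exists_infDist_eq_dist ⟨x₀, hx₀⟩ y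
  have hle : dist y z ≤ dist y x₀ := hd ▸ infDist_le_dist_of_mem hx₀
  have hsub : closedBall y (dist z y) ⊆ closedBall x₀ ρ :=
    closedBall_subset_closedBall' (by rw [dist_comm z y]; linarith)
  refine ⟨z, hz, hd, hsub (mem_closedBall.2 le_rfl), hsub.trans hU, ?_⟩
  rw [dist_comm z y, ← hd]
  exact disjoint_ball_infDist

/-- Grönwall for the squared distance to `C`. With `z` a foot of `γ t`, its upper right derivative
is at most `2⟨γ t - z, X (γ t)⟩`. Tangency allows `X z` to be subtracted from `X (γ t)`, and the
Lipschitz bound leaves `2K` times the squared distance. -/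
theorem IsTangentTo.integralCurve_mem [ProperSpace V] {U C : Set V} (hC : IsClosed C)
    {x₀ : V} {ρ : ℝ} (hx₀ : x₀ ∈ C) (hU : closedBall x₀ ρ ⊆ U) {X : V → V}
    (hX : IsTangentTo U C X) {K : ℝ≥0} (hL : LipschitzOnWith K X (closedBall x₀ ρ))
    {γ : ℝ → V} {T : ℝ} (h0 : γ 0 ∈ C) (hγ : ∀ t ∈ Icc 0 T, HasDerivAt γ (X (γ t)) t)
    (hmem : ∀ t ∈ Icc 0 T, 2 * dist (γ t) x₀ ≤ ρ) : ∀ t ∈ Icc 0 T, γ t ∈ C := by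
  have key : ∀ t ∈ Icc 0 T, infDist (γ t) C ^ 2 ≤ gronwallBound 0 (2 * K) 0 (t - 0) := by
    refine le_gronwallBound_of_liminf_deriv_right_le
      (f' := fun t => 2 * K * infDist (γ t) C ^ 2) ?_ ?_ ?_ ?_
    · have : ContinuousOn γ (Icc 0 T) := fun t ht => (hγ t ht).continuousAt.continuousWithinAt
      exact ((continuous_infDist_pt C).comp_continuousOn this).pow 2
    · intro t ht r hr
      have ht' := Ico_subset_Icc_self ht
      obtain ⟨z, hz, hd, hzρ, hzU, hdis⟩ := exists_foot hC hx₀ hU (hmem t ht')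
      have hγρ : γ t ∈ closedBall x₀ ρ := by
        have := hmem t ht'
        have := dist_nonneg (x := γ t) (y := x₀)
        rw [mem_closedBall]; linarith
      -- With `z` frozen, `‖γ s - z‖²` is a smooth majorant of the squared distance, with equality
      -- at `s = t`, so its derivative controls the slopes to the right.
      have hder : HasDerivAt (fun s => ‖γ s - z‖ ^ 2) (2 * inner ℝ (γ t - z) (X (γ t))) t := by
        simpa using ((hγ t ht').sub_const z).norm_sq
      have hb : 2 * inner ℝ (γ t - z) (X (γ t)) < r := by
        refine lt_of_le_of_lt ?_ hr
        have h1 : inner ℝ (γ t - z) (X z) = 0 := by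
          rw [real_inner_comm]; exact hX z hz _ hzU hdis
        have h2 : inner ℝ (γ t - z) (X (γ t)) = inner ℝ (γ t - z) (X (γ t) - X z) := by
          rw [inner_sub_right, h1, sub_zero]
        have h3 : ‖X (γ t) - X z‖ ≤ K * ‖γ t - z‖ := hL.norm_sub_le hγρ hzρ
        have h4 := real_inner_le_norm (γ t - z) (X (γ t) - X z)
        rw [hd, dist_eq_norm, h2]
        nlinarith [norm_nonneg (γ t - z)]
      have hev := hder.hasDerivWithinAt.limsup_slope_le' (s := Ioi t) (by simp) hb
      refine (Eventually.frequently ?_)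
      filter_upwards [hev, self_mem_nhdsWithin] with s hs hst
      refine lt_of_le_of_lt ?_ hs
      rw [slope_def_module, smul_eq_mul]
      have : 0 < s - t := sub_pos.2 hst
      gcongr
      · exact infDist_nonneg
      · rw [← dist_eq_norm]; exact infDist_le_dist_of_mem hz
      · rw [hd, dist_eq_norm]
    · simp [infDist_zero_of_mem h0]
    · intro t _; simp
  intro t ht
  have h := key t ht
  rw [gronwallBound_ε0_δ0] at h
  have h' : infDist (γ t) C = 0 := by
    have := infDist_nonneg (x := γ t) (s := C)
    nlinarith
  exact (hC.mem_iff_infDist_zero ⟨x₀, hx₀⟩).2 h'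

/-- There is an arc in `C` of the form `x₀ + s a + s² b + o(s²)` as `s → 0+`. -/
def HasSecondOrderArc (C : Set V) (x₀ a b : V) : Prop :=
  ∃ y : ℝ → V, (∀ᶠ s in 𝓝[>] (0 : ℝ), y s ∈ C) ∧
    (fun s => y s - x₀ - s • a - s ^ 2 • b) =o[𝓝[>] 0] fun s => s ^ 2

/-- Along the curve `X (γ s t) = X x₀ + D (s a + t X x₀) + o(s)`. Integration over `[0, s]` adds `s
X x₀ + s² (D a + ½ D (X x₀))`. Differentiability of `X` at the single point `x₀` suffices. -/
theorem second_order_expansion {W : Type*} [NormedAddCommGroup W] [NormedSpace ℝ W]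
    {X : W → W} {x₀ : W} {D : W →L[ℝ] W}
    (hD : HasFDerivAt X D x₀) {y : ℝ → W} {a b : W} {M : ℝ} {γ : ℝ → ℝ → W}
    (hy : (fun s => y s - x₀ - s • a - s ^ 2 • b) =o[𝓝[>] 0] fun s => s ^ 2)
    (hγ : ∀ᶠ s in 𝓝[>] (0 : ℝ), γ s 0 = y s ∧ ∀ t ∈ Icc 0 s,
      HasDerivAt (γ s) (X (γ s t)) t ∧ ‖γ s t - y s‖ ≤ M * t) :
    (fun s => γ s s - x₀ - s • (a + X x₀) - s ^ 2 • (b + D a + (1 / 2 : ℝ) • D (X x₀)))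
      =o[𝓝[>] 0] fun s => s ^ 2 := by
  rw [isLittleO_iff] at hy ⊢
  intro ε hε
  -- For small `s`, `B s²` bounds `y s - x₀ - s a`, `A s` bounds `γ s t - x₀`, and `N s` bounds `X
  -- (γ s t) - X x₀`. The choice of `η` makes `η A = ε / 3`.
  set B : ℝ := ‖b‖ + 1 with hB
  set A : ℝ := ‖a‖ + B + |M| with hA
  have hB0 : 0 < B := by positivity
  have hA0 : 0 < A := by positivity
  set η : ℝ := ε / (3 * A) with hη
  have hη0 : 0 < η := by positivity
  set N : ℝ := (η + ‖D‖) * A with hN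
  have hN0 : 0 ≤ N := by positivity
  obtain ⟨δ, hδ, hDδ⟩ := Metric.eventually_nhds_iff.1
    ((isLittleO_iff.1 hD.isLittleO) hη0)
  have hsmall : ∀ c : ℝ, 0 < c → ∀ R : ℝ, 0 ≤ R → ∀ᶠ s in 𝓝[>] (0 : ℝ), s * R < c := by
    intro c hc R hR
    have : Tendsto (fun s : ℝ => s * R) (𝓝[>] 0) (𝓝 (0 * R)) :=
      (tendsto_id.mul_const R).mono_left nhdsWithin_le_nhds
    rw [zero_mul] at this
    exact this.eventually (gt_mem_nhds hc)
  filter_upwards [hy zero_lt_one, hy (show 0 < ε / 3 by positivity), hγ, self_mem_nhdsWithin,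
    hsmall δ hδ A hA0.le, hsmall 1 one_pos 1 zero_le_one,
    hsmall (ε / 3) (by positivity) (‖D‖ * (N + B)) (by positivity)]
    with s hy1 hyε hγs hs hsδ hs1 hsε
  have hs0 : 0 < s := hs
  obtain ⟨hγ0, hγt⟩ := hγs
  have hn : ‖s ^ 2‖ = s ^ 2 := by simp
  rw [hn] at hy1 hyε ⊢
  have hya : ‖y s - x₀ - s • a‖ ≤ B * s ^ 2 := by
    have : y s - x₀ - s • a = (y s - x₀ - s • a - s ^ 2 • b) + s ^ 2 • b := by abel
    rw [this]
    refine (norm_add_le _ _).trans ?_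
    rw [norm_smul, hn]
    nlinarith
  have hγx : ∀ t ∈ Icc 0 s, ‖γ s t - x₀‖ ≤ A * s := by
    intro t ht
    have : γ s t - x₀ = (γ s t - y s) + (y s - x₀ - s • a) + s • a := by abel
    rw [this]
    refine (norm_add₃_le).trans ?_
    have h1 := (hγt t ht).2
    have h2 : M * t ≤ |M| * s := by
      refine (mul_le_mul_of_nonneg_right (le_abs_self M) ht.1).trans ?_
      exact mul_le_mul_of_nonneg_left ht.2 (abs_nonneg M)
    have h3 : B * s ^ 2 ≤ B * s := by
      refine mul_le_mul_of_nonneg_left ?_ hB0.le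
      nlinarith
    rw [norm_smul, Real.norm_of_nonneg hs0.le, hA]
    linarith
  have hXlin : ∀ t ∈ Icc 0 s, ‖X (γ s t) - X x₀ - D (γ s t - x₀)‖ ≤ η * (A * s) := by
    intro t ht
    have hd : dist (γ s t) x₀ < δ := by
      rw [dist_eq_norm]; exact (hγx t ht).trans_lt (by linarith)
    exact (hDδ hd).trans (mul_le_mul_of_nonneg_left (hγx t ht) hη0.le)
  have hDle : ∀ w : W, ‖D w‖ ≤ ‖D‖ * ‖w‖ := D.le_opNorm
  have hfirst : ∀ t ∈ Icc 0 s, ‖γ s t - x₀ - s • a - t • X x₀‖ ≤ (N + B) * s ^ 2 := by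
    intro t ht
    have hmv := norm_image_sub_le_of_norm_deriv_le_segment' (a := 0) (b := s)
      (f := fun t => γ s t - t • X x₀) (f' := fun t => X (γ s t) - (1 : ℝ) • X x₀) (C := N * s)
      (fun r hr => ((hγt r hr).1.sub ((hasDerivAt_id r).smul_const (X x₀))).hasDerivWithinAt)
      (fun r hr => by
        have hr' := Ico_subset_Icc_self hr
        have : X (γ s r) - (1 : ℝ) • X x₀
            = (X (γ s r) - X x₀ - D (γ s r - x₀)) + D (γ s r - x₀) := by rw [one_smul]; abel
        rw [this]
        refine (norm_add_le _ _).trans ?_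
        have h1 := hXlin r hr'
        have h2 := (hDle (γ s r - x₀)).trans
          (mul_le_mul_of_nonneg_left (hγx r hr') (norm_nonneg D))
        rw [hN]; linarith) t ht
    have h0 : (fun t => γ s t - t • X x₀) 0 = y s := by simp [hγ0]
    have : γ s t - x₀ - s • a - t • X x₀
        = ((fun t => γ s t - t • X x₀) t - (fun t => γ s t - t • X x₀) 0)
          + (y s - x₀ - s • a) := by rw [h0]; simp only; abel
    rw [this]
    refine (norm_add_le _ _).trans ?_
    have h3 : N * s * (t - 0) ≤ N * s * s := by
      refine mul_le_mul_of_nonneg_left ?_ (by positivity)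
      linarith [ht.2]
    nlinarith
  -- The predicted increments are subtracted, so that the derivative of `h` is only the remainder,
  -- small compared with `s`.
  set h : ℝ → W := fun t => γ s t - t • X x₀ - (s * t) • D a - (t ^ 2 / 2) • D (X x₀) with hh
  have hder : ∀ t ∈ Icc 0 s, HasDerivAt h
      (X (γ s t) - (1 : ℝ) • X x₀ - (s * 1) • D a - (2 * t ^ (2 - 1) * 1 / 2) • D (X x₀)) t := by
    intro t ht
    exact (((hγt t ht).1.sub ((hasDerivAt_id t).smul_const (X x₀))).sub
      (((hasDerivAt_id t).const_mul s).smul_const (D a))).sub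
      ((((hasDerivAt_id t).pow 2).div_const 2).smul_const (D (X x₀)))
  have hmv := norm_image_sub_le_of_norm_deriv_le_segment' (a := 0) (b := s) (f := h)
    (C := η * (A * s) + ‖D‖ * ((N + B) * s ^ 2))
    (fun r hr => (hder r hr).hasDerivWithinAt)
    (fun r hr => by
      have hr' := Ico_subset_Icc_self hr
      have : X (γ s r) - (1 : ℝ) • X x₀ - (s * 1) • D a - (2 * r ^ (2 - 1) * 1 / 2) • D (X x₀)
          = (X (γ s r) - X x₀ - D (γ s r - x₀)) + D (γ s r - x₀ - s • a - r • X x₀) := by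
        have e : (2 * r ^ (2 - 1) * 1 / 2 : ℝ) = r := by norm_num
        rw [e]
        simp only [map_sub, map_smul, one_smul, mul_one]
        abel
      rw [this]
      refine (norm_add_le _ _).trans (add_le_add (hXlin r hr') ?_)
      exact (hDle _).trans (mul_le_mul_of_nonneg_left (hfirst r hr') (norm_nonneg D)))
    s (right_mem_Icc.2 hs0.le)
  have hend : γ s s - x₀ - s • (a + X x₀) - s ^ 2 • (b + D a + (1 / 2 : ℝ) • D (X x₀))
      = (h s - h 0) + (y s - x₀ - s • a - s ^ 2 • b) := by
    simp only [hh, hγ0]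
    module
  rw [hend]
  refine (norm_add_le _ _).trans ?_
  have e1 : η * (A * s) * s = ε / 3 * s ^ 2 := by
    rw [hη]; field_simp
  have e2 : ‖D‖ * ((N + B) * s ^ 2) * s ≤ ε / 3 * s ^ 2 := by
    have : ‖D‖ * ((N + B) * s ^ 2) * s = (s * (‖D‖ * (N + B))) * s ^ 2 := by ring
    rw [this]
    exact mul_le_mul_of_nonneg_right hsε.le (sq_nonneg s)
  rw [sub_zero, add_mul] at hmv
  linarith

/-- The new arc follows the flow of `X` for time `s` from the point `y s`. A common existence time
for all starting points near `x₀` makes this possible, and invariance keeps the endpoints in `C`. -/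
theorem IsTangentTo.hasSecondOrderArc_step [ProperSpace V] {U C : Set V} (hU : IsOpen U)
    (hC : IsClosed C) {X : V → V} (hX : IsTangentTo U C X) (hXd : ContDiffOn ℝ 1 X U)
    {x₀ a b : V} (hx₀ : x₀ ∈ C) (hx₀U : x₀ ∈ U) (h : HasSecondOrderArc C x₀ a b) :
    HasSecondOrderArc C x₀ (a + X x₀)
      (b + fderiv ℝ X x₀ a + (1 / 2 : ℝ) • fderiv ℝ X x₀ (X x₀)) := by
  obtain ⟨y, hyC, hy⟩ := h
  have hXat : ContDiffAt ℝ 1 X x₀ := hXd.contDiffAt (hU.mem_nhds hx₀U)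
  obtain ⟨r, hr, ε, hε, hflow⟩ :=
    hXat.exists_forall_mem_closedBall_exists_eq_forall_mem_Ioo_hasDerivAt 0
  obtain ⟨K, S, hS, hL⟩ := hXat.exists_lipschitzOnWith
  set M : ℝ := ‖X x₀‖ + 1 with hM
  have hnear : ∀ᶠ x in 𝓝 x₀, x ∈ S ∧ x ∈ U ∧ ‖X x‖ < M :=
    (eventually_mem_set.2 hS).and ((hU.eventually_mem hx₀U).and
      (hXat.continuousAt.norm.eventually (gt_mem_nhds (by simp [hM]))))
  obtain ⟨ρ, hρ, hball⟩ := Metric.nhds_basis_closedBall.eventually_iff.1 hnear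
  have hyt : Tendsto y (𝓝[>] 0) (𝓝 x₀) := by
    have h1 : Tendsto (fun s : ℝ => s ^ 2) (𝓝[>] 0) (𝓝 0) := by
      have : Tendsto (fun s : ℝ => s ^ 2) (𝓝 0) (𝓝 (0 ^ 2)) := (continuous_pow 2).tendsto 0
      simpa using this.mono_left nhdsWithin_le_nhds
    have h2 := hy.trans_tendsto h1
    have h3 : Tendsto (fun s : ℝ => x₀ + s • a + s ^ 2 • b) (𝓝[>] 0) (𝓝 x₀) := by
      have : Continuous (fun s : ℝ => x₀ + s • a + s ^ 2 • b) := by fun_prop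
      simpa using (this.tendsto 0).mono_left nhdsWithin_le_nhds
    have h4 := h2.add h3
    rw [zero_add] at h4
    exact h4.congr (fun s => by abel)
  have hev : ∀ᶠ s in 𝓝[>] (0 : ℝ), ∃ α : ℝ → V, (α 0 = y s ∧ ∀ t ∈ Icc 0 s,
      HasDerivAt α (X (α t)) t ∧ ‖α t - y s‖ ≤ M * t) ∧ α s ∈ C := by
    have hs1 : ∀ᶠ s in 𝓝[>] (0 : ℝ), s < ε ∧ M * s < ρ / 4 := by
      have : Tendsto (fun s : ℝ => M * s) (𝓝 0) (𝓝 (M * 0)) := (continuous_const_mul M).tendsto 0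
      rw [mul_zero] at this
      exact ((gt_mem_nhds hε).and (this.eventually (gt_mem_nhds (by positivity)))).filter_mono
        nhdsWithin_le_nhds
    filter_upwards [hyC, hs1, self_mem_nhdsWithin, hyt.eventually (closedBall_mem_nhds x₀ hr),
      hyt.eventually (closedBall_mem_nhds x₀ (show 0 < ρ / 4 by positivity))]
      with s hsC hsε hs hsr hsρ
    obtain ⟨α, hα0, hα⟩ := hflow _ hsr
    have hs0 : 0 < s := hs
    have hM0 : 0 < M := by positivity
    have hder : ∀ t ∈ Icc 0 s, HasDerivAt α (X (α t)) t := fun t ht =>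
      hα t ⟨by linarith [ht.1], by linarith [ht.2]⟩
    have hnorm : ∀ t ∈ Icc 0 s, ‖α t - y s‖ ≤ M * t → 2 * dist (α t) x₀ ≤ ρ := by
      intro t ht hle
      have h1 : M * t ≤ M * s := mul_le_mul_of_nonneg_left ht.2 hM0.le
      have h2 := dist_triangle (α t) (y s) x₀
      rw [dist_eq_norm (α t) (y s)] at h2
      have h3 : dist (y s) x₀ ≤ ρ / 4 := hsρ
      linarith
    -- The speed bound `M` is known only near `x₀`. The comparison principle needs it only when `‖α
    -- t - y s‖ = M t`, and then the two bounds `ρ / 4` still place `α t` within `ρ / 2` of `x₀`.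
    have hconf : ∀ t ∈ Icc 0 s, ‖α t - y s‖ ≤ M * t := by
      refine fun t ht => image_norm_le_of_norm_deriv_right_lt_deriv_boundary'
        (f := fun t => α t - y s) (f' := fun t => X (α t)) (B := fun t => M * t)
        (B' := fun _ => M * 1) ?_ ?_ ?_ ?_ ?_ ?_ ht
      · exact fun r hr => ((hder r hr).sub_const _).continuousAt.continuousWithinAt
      · exact fun r hr => ((hder r (Ico_subset_Icc_self hr)).sub_const _).hasDerivWithinAt
      · simp [hα0]
      · exact (continuous_const_mul M).continuousOn
      · exact fun r _ => ((hasDerivAt_id r).const_mul M).hasDerivWithinAt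
      · intro r hr hle
        rw [mul_one]
        refine (hball ?_).2.2
        have := hnorm r (Ico_subset_Icc_self hr) hle.le
        have := dist_nonneg (x := α r) (y := x₀)
        rw [mem_closedBall]; linarith
    refine ⟨α, ⟨hα0, fun t ht => ⟨hder t ht, hconf t ht⟩⟩, ?_⟩
    exact hX.integralCurve_mem hC hx₀ (fun x hx => (hball hx).2.1)
      (hL.mono fun x hx => (hball hx).1) (hα0 ▸ hsC) hder
      (fun t ht => hnorm t ht (hconf t ht)) s (right_mem_Icc.2 hs0.le)
  choose! γ hγ using fun (s : ℝ) (h : ∃ α : ℝ → V, (α 0 = y s ∧ ∀ t ∈ Icc 0 s,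
      HasDerivAt α (X (α t)) t ∧ ‖α t - y s‖ ≤ M * t) ∧ α s ∈ C) => h
  refine ⟨fun s => γ s s, hev.mono fun s hs => (hγ s hs).2, ?_⟩
  exact second_order_expansion (hXat.differentiableAt one_ne_zero).hasFDerivAt hy
    (hev.mono fun s hs => (hγ s hs).1)

/-- Points `z s` outside the ball satisfy `⟨z s - x₀, y - x₀⟩ ≤ ½ ‖z s - x₀‖²`. The right side is
`O(s⁴)`, so division by `s²` leaves the sign in the limit. -/
theorem HasSecondOrderArc.inner_le_zero {C : Set V} {x₀ w y : V}
    (h : HasSecondOrderArc C x₀ 0 w) (hy : Disjoint (ball y (dist x₀ y)) C) :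
    inner ℝ w (y - x₀) ≤ 0 := by
  obtain ⟨z, hzC, hz⟩ := h
  have hq : Tendsto (fun s : ℝ => (s ^ 2)⁻¹ • (z s - x₀)) (𝓝[>] 0) (𝓝 w) := by
    have h1 := hz.tendsto_inv_smul_nhds_zero.add_const w
    rw [zero_add] at h1
    refine h1.congr' ?_
    filter_upwards [self_mem_nhdsWithin] with s hs
    have hs0 : s ≠ 0 := ne_of_gt hs
    rw [smul_zero, sub_zero, smul_sub _ (z s - x₀), smul_smul, inv_mul_cancel₀ (by positivity),
      one_smul, sub_add_cancel]
  have h1 : Tendsto (fun s : ℝ => inner ℝ ((s ^ 2)⁻¹ • (z s - x₀)) (y - x₀)) (𝓝[>] 0)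
      (𝓝 (inner ℝ w (y - x₀))) := hq.inner tendsto_const_nhds
  have h2 : Tendsto (fun s : ℝ => s ^ 2 * ‖(s ^ 2)⁻¹ • (z s - x₀)‖ ^ 2 / 2) (𝓝[>] 0)
      (𝓝 (0 ^ 2 * ‖w‖ ^ 2 / 2)) := by
    have h0 : Tendsto (fun s : ℝ => s ^ 2) (𝓝[>] 0) (𝓝 (0 ^ 2)) :=
      ((continuous_pow 2).tendsto 0).mono_left nhdsWithin_le_nhds
    exact (h0.mul (hq.norm.pow 2)).div_const 2
  have h3 : (0 : ℝ) = 0 ^ 2 * ‖w‖ ^ 2 / 2 := by ring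
  rw [h3]
  refine le_of_tendsto_of_tendsto h1 h2 ?_
  filter_upwards [hzC, self_mem_nhdsWithin] with s hs hs0
  have hs0 : 0 < s := hs0
  have hout : dist x₀ y ≤ dist (z s) y := by
    by_contra hlt
    exact disjoint_left.1 hy (mem_ball.2 (not_le.1 hlt)) hs
  have hsq : ‖y - x₀‖ ^ 2 ≤ ‖(y - x₀) - (z s - x₀)‖ ^ 2 := by
    have e1 : dist x₀ y = ‖y - x₀‖ := by rw [dist_comm, dist_eq_norm]
    have e2 : dist (z s) y = ‖(y - x₀) - (z s - x₀)‖ := by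
      rw [dist_comm, dist_eq_norm]; congr 1; abel
    rw [← e1, ← e2]
    gcongr
  rw [norm_sub_sq_real (y - x₀) (z s - x₀)] at hsq
  have hin : inner ℝ (z s - x₀) (y - x₀) ≤ ‖z s - x₀‖ ^ 2 / 2 := by
    rw [real_inner_comm]; linarith
  rw [real_inner_smul_left, norm_smul, mul_pow, norm_inv, Real.norm_of_nonneg (sq_nonneg s)]
  have hp : 0 < (s ^ 2)⁻¹ := by positivity
  calc (s ^ 2)⁻¹ * inner ℝ (z s - x₀) (y - x₀) ≤ (s ^ 2)⁻¹ * (‖z s - x₀‖ ^ 2 / 2) := by gcongr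
    _ = s ^ 2 * ((s ^ 2)⁻¹ ^ 2 * ‖z s - x₀‖ ^ 2) / 2 := by field_simp

theorem IsTangentTo.zero (U C : Set V) : IsTangentTo U C 0 := fun _ _ _ _ _ => by simp

theorem IsTangentTo.add {U C : Set V} {X Y : V → V} (hX : IsTangentTo U C X)
    (hY : IsTangentTo U C Y) : IsTangentTo U C (X + Y) := fun z hz y h1 h2 => by
  rw [Pi.add_apply, inner_add_left, hX z hz y h1 h2, hY z hz y h1 h2, add_zero]

theorem IsTangentTo.smul {U C : Set V} {X : V → V} (hX : IsTangentTo U C X) (c : V → ℝ) :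
    IsTangentTo U C (fun x => c x • X x) := fun z hz y h1 h2 => by
  rw [real_inner_smul_left, hX z hz y h1 h2, mul_zero]

theorem IsTangentTo.neg {U C : Set V} {X : V → V} (hX : IsTangentTo U C X) :
    IsTangentTo U C (-X) := fun z hz y h1 h2 => by
  rw [Pi.neg_apply, inner_neg_left, hX z hz y h1 h2, neg_zero]

/-- Flowing along `X`, `Y`, `-X`, `-Y` for time `s` each cancels the first order and leaves `DY X -
DX Y` at second order. -/
theorem IsTangentTo.hasSecondOrderArc_lieBracket [ProperSpace V] {U C : Set V} (hU : IsOpen U)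
    (hC : IsClosed C) {X Y : V → V} (hX : IsTangentTo U C X) (hY : IsTangentTo U C Y)
    (hXd : ContDiffOn ℝ 1 X U) (hYd : ContDiffOn ℝ 1 Y U)
    {x₀ : V} (hx₀ : x₀ ∈ C) (hx₀U : x₀ ∈ U) :
    HasSecondOrderArc C x₀ 0 (VectorField.lieBracket ℝ X Y x₀) := by
  have h0 : HasSecondOrderArc C x₀ 0 0 :=
    ⟨fun _ => x₀, Eventually.of_forall fun _ => hx₀, by simp⟩
  have h1 := hX.hasSecondOrderArc_step hU hC hXd hx₀ hx₀U h0
  have h2 := hY.hasSecondOrderArc_step hU hC hYd hx₀ hx₀U h1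
  have h3 := hX.neg.hasSecondOrderArc_step hU hC hXd.neg hx₀ hx₀U h2
  have h4 := hY.neg.hasSecondOrderArc_step hU hC hYd.neg hx₀ hx₀U h3
  convert h4 using 1
  · simp
  · simp only [VectorField.lieBracket, fderiv_neg, Pi.neg_apply, neg_apply, map_neg,
      map_add, map_zero]
    module

/-- The arc gives only an inequality. Exchanging `X` and `Y` reverses the sign of the bracket and
supplies the other one. -/
theorem IsTangentTo.lieBracket [ProperSpace V] {U C : Set V} (hU : IsOpen U)
    (hC : IsClosed C) {X Y : V → V} (hX : IsTangentTo U C X) (hY : IsTangentTo U C Y)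
    (hXd : ContDiffOn ℝ 1 X U) (hYd : ContDiffOn ℝ 1 Y U) :
    IsTangentTo U C (VectorField.lieBracket ℝ X Y) := by
  intro z hz y hyU hy
  have hzU : z ∈ U := hyU (mem_closedBall.2 le_rfl)
  have h1 := (hX.hasSecondOrderArc_lieBracket hU hC hY hXd hYd hz hzU).inner_le_zero hy
  have h2 := (hY.hasSecondOrderArc_lieBracket hU hC hX hYd hXd hz hzU).inner_le_zero hy
  rw [VectorField.lieBracket_swap, inner_neg_left] at h2
  linarith

theorem LieSpan.isTangentTo {m : ℕ} {ι : Type} {U C : Set (E m)} (hU : IsOpen U)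
    (hC : IsClosed C) {X : ι → E m → E m} (hX : ∀ i, IsTangentTo U C (X i)) {Z : E m → E m}
    (hZ : LieSpan U X Z) : IsTangentTo U C Z := by
  induction hZ with
  | gen i => exact hX i
  | zero => exact .zero U C
  | add _ _ h1 h2 => exact h1.add h2
  | smul _ _ h => exact h.smul _
  | bracket h1 h2 _ _ h3 h4 => exact h3.lieBracket hU hC h4 h1 h2

/-- A closed set that meets `U` and to which a family of full rank is tangent contains `U`. -/
theorem subset_of_isTangentTo_of_lieRank {m : ℕ} {ι : Type} {U C : Set (E m)} (hU : IsOpen U)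
    (hUc : IsPreconnected U) (hC : IsClosed C) {X : ι → E m → E m}
    (hX : ∀ i, IsTangentTo U C (X i)) (hr : ∀ q ∈ U, lieRank U X q = m)
    (hne : (U ∩ C).Nonempty) : U ⊆ C := by
  have hnormal : ∀ z ∈ C, ∀ y, closedBall y (dist z y) ⊆ U →
      Disjoint (ball y (dist z y)) C → y = z := by
    intro z hz y hyU hy
    have htop : Submodule.span ℝ {w : E m | ∃ Z : E m → E m, LieSpan U X Z ∧ Z z = w} = ⊤ := by
      apply Submodule.eq_top_of_finrank_eq
      rw [finrank_euclideanSpace_fin]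
      exact hr z (hyU (mem_closedBall.2 le_rfl))
    have hmem : y - z ∈ Submodule.span ℝ {w : E m | ∃ Z : E m → E m, LieSpan U X Z ∧ Z z = w} :=
      htop ▸ Submodule.mem_top
    have : ∀ w ∈ Submodule.span ℝ {w : E m | ∃ Z : E m → E m, LieSpan U X Z ∧ Z z = w},
        inner ℝ w (y - z) = 0 := by
      intro w hw
      induction hw using Submodule.span_induction with
      | mem w hw =>
        obtain ⟨Z, hZ, rfl⟩ := hw
        exact hZ.isTangentTo hU hC hX z hz y hyU hy
      | zero => simp
      | add a b _ _ h1 h2 => rw [inner_add_left, h1, h2, add_zero]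
      | smul c a _ h => rw [real_inner_smul_left, h, mul_zero]
    exact sub_eq_zero.1 (inner_self_eq_zero.1 (this _ hmem))
  -- A point `y` close to `C` is the centre of a ball touching `C` at its foot `z`. Since `hnormal`
  -- forces `y = z`, `y` lies in `C`.
  have hopen : U ∩ C ⊆ interior C := by
    rintro x ⟨hxU, hxC⟩
    obtain ⟨ρ, hρ, hball⟩ := Metric.nhds_basis_closedBall.mem_iff.1 (hU.mem_nhds hxU)
    refine mem_interior_iff_mem_nhds.2 (Metric.mem_nhds_iff.2 ⟨ρ / 2, by positivity, ?_⟩)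
    intro y hy
    obtain ⟨z, hz, -, -, hzU, hdis⟩ := exists_foot hC hxC hball
      (y := y) (by linarith [mem_ball.1 hy])
    exact hnormal z hz y hzU hdis ▸ hz
  have := hUc.subset_of_closure_inter_subset (u := interior C) isOpen_interior
    (by obtain ⟨x, hx⟩ := hne; exact ⟨x, hx.1, hopen hx⟩)
    (fun x hx => hopen ⟨hx.2, hC.closure_interior_subset hx.1⟩)
  exact this.trans interior_subset

end Tangency
end HorizontalCurvature

namespace HorizontalCurvature

/-! ### Second-order conditions at a local minimum. -/

section Hopf

open Metric Set Filter Topology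

/-- A negative second derivative would make `t` a local maximum too, hence `g` locally constant,
with second derivative zero. -/
theorem deriv_deriv_nonneg_of_isLocalMin {g g' : ℝ → ℝ} {t g'' : ℝ} (h : IsLocalMin g t)
    (hg : ∀ᶠ s in 𝓝 t, HasDerivAt g (g' s) s) (hg' : HasDerivAt g' g'' t) : 0 ≤ g'' := by
  by_contra! hneg
  have hd : deriv g =ᶠ[𝓝 t] g' := hg.mono fun s hs => hs.deriv
  have hdd : deriv (deriv g) t = g'' := hd.deriv_eq.trans hg'.deriv
  have hmax := isLocalMax_of_deriv_deriv_neg (hdd ▸ hneg) h.deriv_eq_zero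
    hg.self_of_nhds.continuousAt
  have hconst : g =ᶠ[𝓝 t] fun _ => g t := by
    filter_upwards [h, hmax] with s h1 h2 using le_antisymm h2 h1
  have h0 : deriv (deriv g) t = 0 := by
    rw [hconst.deriv.deriv_eq]; simp
  exact hneg.ne (hdd.symm.trans h0)

variable {V : Type*} [NormedAddCommGroup V] [NormedSpace ℝ V]

theorem hasDerivAt_line_of_contDiffAt {f : V → ℝ} {x : V} (hf : ContDiffAt ℝ 2 f x) (w : V) :
    (∀ᶠ t in 𝓝 (0 : ℝ), HasDerivAt (fun t : ℝ => f (x + t • w)) (fderiv ℝ f (x + t • w) w) t) ∧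
      HasDerivAt (fun t : ℝ => fderiv ℝ f (x + t • w) w) (fderiv ℝ (fderiv ℝ f) x w w) 0 := by
  have hline : ∀ t : ℝ, HasDerivAt (fun t : ℝ => x + t • w) w t := fun t => by
    simpa using ((hasDerivAt_id t).smul_const w).const_add x
  have hev : ∀ᶠ p in 𝓝 x, ContDiffAt ℝ 2 f p := hf.eventually (by simp)
  have hlim : Tendsto (fun t : ℝ => x + t • w) (𝓝 0) (𝓝 x) := by
    simpa using (hline 0).continuousAt.tendsto
  refine ⟨(hlim.eventually hev).mono fun t ht => ?_, ?_⟩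
  · exact (ht.differentiableAt two_ne_zero).hasFDerivAt.comp_hasDerivAt t (hline t)
  · have h1 : DifferentiableAt ℝ (fderiv ℝ f) x :=
      (hf.fderiv_right (m := 1) (by norm_num)).differentiableAt one_ne_zero
    have h2 : HasFDerivAt (fderiv ℝ f) (fderiv ℝ (fderiv ℝ f) x) (x + (0 : ℝ) • w) := by
      simpa using h1.hasFDerivAt
    have h3 := h2.comp_hasDerivAt (0 : ℝ) (hline 0)
    simpa using h3.clm_apply (hasDerivAt_const (0 : ℝ) w)

theorem fderiv_eq_and_fderiv_fderiv_le_of_isLocalMin_sub {f g : V → ℝ} {x : V}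
    (h : IsLocalMin (fun p => f p - g p) x) (hf : ContDiffAt ℝ 2 f x)
    (hg : ContDiffAt ℝ 2 g x) :
    fderiv ℝ f x = fderiv ℝ g x ∧
      ∀ w, fderiv ℝ (fderiv ℝ g) x w w ≤ fderiv ℝ (fderiv ℝ f) x w w := by
  constructor
  · have h1 := h.fderiv_eq_zero
    rw [fderiv_fun_sub (hf.differentiableAt two_ne_zero) (hg.differentiableAt two_ne_zero)] at h1
    exact sub_eq_zero.1 h1
  · intro w
    obtain ⟨f1, f2⟩ := hasDerivAt_line_of_contDiffAt hf w
    obtain ⟨g1, g2⟩ := hasDerivAt_line_of_contDiffAt hg w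
    have hlim : Tendsto (fun t : ℝ => x + t • w) (𝓝 0) (𝓝 x) := by
      have : Continuous (fun t : ℝ => x + t • w) := by fun_prop
      simpa using this.tendsto 0
    have hmin : IsLocalMin (fun t : ℝ => f (x + t • w) - g (x + t • w)) 0 := by
      have := hlim.eventually h
      simpa [IsLocalMin, IsMinFilter] using this
    have := deriv_deriv_nonneg_of_isLocalMin hmin
      ((f1.and g1).mono fun t ht => ht.1.sub ht.2) (f2.sub g2)
    linarith

end Hopf

/-! ### Derivatives of the Gaussian barrier. -/

section Barrier

open Metric Set Filter Topology

variable {V : Type*} [NormedAddCommGroup V] [InnerProductSpace ℝ V]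

/-- The Gaussian barrier `ε (exp (-k |p - y|²) - exp (-k r²))`. -/
noncomputable def barrier (ε k r : ℝ) (y p : V) : ℝ :=
  ε * (Real.exp (-k * ‖p - y‖ ^ 2) - Real.exp (-k * r ^ 2))

theorem contDiff_barrier (ε k r : ℝ) (y : V) : ContDiff ℝ 2 (barrier ε k r y) := by
  unfold barrier
  exact contDiff_const.mul ((Real.contDiff_exp.comp
    (contDiff_const.mul ((contDiff_id.sub contDiff_const).norm_sq ℝ))).sub contDiff_const)

theorem fderiv_barrier_apply (ε k r : ℝ) (y p w : V) : fderiv ℝ (barrier ε k r y) p w =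
    -(2 * k * ε * Real.exp (-k * ‖p - y‖ ^ 2)) * inner ℝ (p - y) w := by
  have h1 : HasFDerivAt (fun p => ‖p - y‖ ^ 2) _ p := ((hasFDerivAt_id p).sub_const y).norm_sq
  have h2 := ((h1.const_mul (-k)).exp.sub_const (Real.exp (-k * r ^ 2))).const_mul ε
  have h3 : fderiv ℝ (barrier ε k r y) p = _ := h2.fderiv
  rw [h3]
  simp [inner_sub_left]
  ring

theorem norm_fderiv_barrier_le {ε k : ℝ} (hε : 0 ≤ ε) (hk : 0 ≤ k) (r : ℝ) (y p : V) :
    ‖fderiv ℝ (barrier ε k r y) p‖ ≤ 2 * k * ε * Real.exp (-k * ‖p - y‖ ^ 2) * ‖p - y‖ := by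
  refine ContinuousLinearMap.opNorm_le_bound _ (by positivity) fun w => ?_
  rw [fderiv_barrier_apply, norm_mul, norm_neg, Real.norm_of_nonneg (by positivity),
    mul_assoc _ ‖p - y‖]
  gcongr
  exact norm_inner_le_norm _ _

theorem fderiv_fderiv_barrier_apply (ε k r : ℝ) (y p w : V) :
    fderiv ℝ (fderiv ℝ (barrier ε k r y)) p w w =
      2 * k * ε * Real.exp (-k * ‖p - y‖ ^ 2) * (2 * k * inner ℝ (p - y) w ^ 2 - ‖w‖ ^ 2) := by
  have h0 : DifferentiableAt ℝ (fderiv ℝ (barrier ε k r y)) p :=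
    ((contDiff_barrier ε k r y).fderiv_right (m := 1) (by norm_num)).differentiable one_ne_zero p
  have h1 : fderiv ℝ (fderiv ℝ (barrier ε k r y)) p w w
      = fderiv ℝ (fun q => fderiv ℝ (barrier ε k r y) q w) p w := by
    rw [fderiv_clm_apply h0 (differentiableAt_const w)]
    simp
  rw [h1]
  simp only [fderiv_barrier_apply]
  have h2 : HasFDerivAt (fun p => ‖p - y‖ ^ 2) _ p := ((hasFDerivAt_id p).sub_const y).norm_sq
  have h3 := (((h2.const_mul (-k)).exp.const_mul (2 * k * ε)).neg).mul
    (((hasFDerivAt_id p).sub_const y).inner ℝ (hasFDerivAt_const w p))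
  have h4 : HasFDerivAt
      (fun q => -(2 * k * ε * Real.exp (-k * ‖q - y‖ ^ 2)) * inner ℝ (q - y) w) _ p := h3
  rw [h4.fderiv]
  simp [inner_sub_left]
  ring

end Barrier

/-! ### The Hopf argument for a degenerate inequality. -/

section HopfLemma

open Metric Set Filter Topology

variable {V : Type*} [NormedAddCommGroup V] [InnerProductSpace ℝ V]

/-- By the parallelogram law. It says that a ball of half the radius, internally tangent at `z`,
meets the larger sphere only at `z`. -/
theorem norm_sub_lt_of_norm_le {q n : V} {r : ℝ} (hq : ‖q‖ ≤ r) (hn : ‖n‖ ≤ r) (hqn : q ≠ -n) :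
    ‖q - n‖ < 2 * r := by
  by_contra! hle
  have hpar := parallelogram_law_with_norm ℝ q n
  have hpos : 0 < ‖q + n‖ := norm_pos_iff.2 fun h => hqn (eq_neg_of_add_eq_zero_left h)
  have := norm_nonneg q
  have := norm_nonneg n
  nlinarith

/-- If some `Xᵢ z` had a component along the normal, a barrier `h` with large exponent would be a
strict subsolution near `z`. But `φ - h` vanishes at `z` and is positive on a small sphere about it,
so it has an interior minimum, where `∇φ = ∇h` and `D²φ ≥ D²h` contradict the inequality. -/
theorem isTangentTo_zeroSet [ProperSpace V] {ι : Type*} [Fintype ι] {U C : Set V} {φ : V → ℝ}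
    (hU : IsOpen U) (hφ : ∀ x ∈ U, ContDiffAt ℝ 2 φ x) (hpos : ∀ x ∈ U, 0 ≤ φ x)
    {X : ι → V → V} (hX : ∀ i, ContinuousOn (X i) U)
    (hineq : ∀ z ∈ U, φ z = 0 → ∃ K : ℝ, ∀ᶠ x in 𝓝 z,
      ∑ i, fderiv ℝ (fderiv ℝ φ) x (X i x) (X i x) ≤ K * ‖fderiv ℝ φ x‖)
    (hC : ∀ x ∈ U, x ∈ C ↔ φ x = 0) (i : ι) : IsTangentTo U C (X i) := by
  intro z hz y hyU hdis
  by_contra hne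
  have hzU : z ∈ U := hyU (mem_closedBall.2 le_rfl)
  have hφz : φ z = 0 := (hC z hzU).1 hz
  obtain ⟨K, hK⟩ := hineq z hzU hφz
  -- shrink the ball so that its closure meets `C` only at `z`
  set n : V := (1 / 2 : ℝ) • (y - z) with hn
  set c : V := z + n with hc
  set r : ℝ := ‖n‖ with hr
  have hzc : z - c = -n := by rw [hc]; abel
  have hdzy : dist z y = 2 * r := by
    rw [dist_comm, dist_eq_norm, hr, hn, norm_smul]; norm_num; ring
  have hφpos : ∀ p, ‖p - c‖ ≤ r → p ≠ z → 0 < φ p := by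
    intro p hp hpz
    have hlt : ‖(p - c) - n‖ < 2 * r := norm_sub_lt_of_norm_le hp le_rfl fun h =>
      hpz (sub_left_injective (h.trans hzc.symm))
    have hpy : p ∈ ball y (dist z y) := by
      rw [mem_ball, dist_eq_norm, hdzy]
      have : p - y = (p - c) - n := by rw [hc, hn]; module
      rwa [this]
    have hpU : p ∈ U := hyU (ball_subset_closedBall hpy)
    refine lt_of_le_of_ne (hpos p hpU) fun h => ?_
    exact disjoint_left.1 hdis hpy ((hC p hpU).2 h.symm)
  -- choice of the exponent
  set S : V → ℝ := fun p => ∑ j, inner ℝ (p - c) (X j p) ^ 2 with hS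
  set Q : V → ℝ := fun p => ∑ j, ‖X j p‖ ^ 2 + |K| * ‖p - c‖ with hQ
  have hXz : ∀ j, ContinuousAt (X j) z := fun j => (hX j).continuousAt (hU.mem_nhds hzU)
  have hScont : ContinuousAt S z := tendsto_finsetSum _ fun j _ =>
    ((continuousAt_id.sub continuousAt_const).inner (hXz j)).pow 2
  have hQcont : ContinuousAt Q z := ContinuousAt.add
    (tendsto_finsetSum _ fun j _ => (hXz j).norm.pow 2)
    (continuousAt_const.mul (continuousAt_id.sub continuousAt_const).norm)
  have hSz : 0 < S z := by
    refine Finset.sum_pos' (fun j _ => sq_nonneg _) ⟨i, Finset.mem_univ i, ?_⟩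
    refine sq_pos_of_ne_zero fun h => hne ?_
    rw [hzc, hn, inner_neg_left, real_inner_smul_left, real_inner_comm] at h
    linarith
  have hQz : 0 ≤ Q z := by positivity
  -- Near `z`, `S` exceeds `s₀` and `Q` stays below `R`, so `2 k s₀ = R` gives `2 k S > Q`: the
  -- normal term of the Hessian beats all others.
  set s₀ : ℝ := S z / 2 with hs₀
  set R : ℝ := Q z + 1 with hR
  set k : ℝ := R / (2 * s₀) with hk
  have hs₀pos : 0 < s₀ := by positivity
  have hRpos : 0 < R := by positivity
  have hkpos : 0 < k := by positivity
  have hnear : ∀ᶠ p in 𝓝 z, p ∈ U ∧ (∑ j, fderiv ℝ (fderiv ℝ φ) p (X j p) (X j p)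
      ≤ K * ‖fderiv ℝ φ p‖) ∧ s₀ < S p ∧ Q p < R :=
    (hU.eventually_mem hzU).and (hK.and ((hScont.eventually (lt_mem_nhds (half_lt_self hSz))).and
      (hQcont.eventually (gt_mem_nhds (lt_add_one _)))))
  obtain ⟨δ, hδ, hball⟩ := Metric.nhds_basis_closedBall.eventually_iff.1 hnear
  have hφcont : ContinuousOn φ (closedBall z δ) := fun p hp =>
    (hφ p (hball hp).1).continuousAt.continuousWithinAt
  -- choice of the factor
  obtain ⟨a, ha, haφ⟩ := ((isCompact_sphere z δ).inter_right
    (isClosed_closedBall (x := c) (ε := r))).exists_forall_le'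
      (hφcont.mono (inter_subset_left.trans sphere_subset_closedBall)) (a := 0)
      (fun p hp => hφpos p (by rw [← dist_eq_norm]; exact hp.2) (ne_of_mem_sphere hp.1 hδ.ne'))
  set ε : ℝ := a / 2 with hε
  have hεpos : 0 < ε := by positivity
  set h : V → ℝ := barrier ε k r c with hh
  -- In the small closed ball `h < ε < a ≤ φ`; outside it `h < 0 ≤ φ`.
  have hsphere : ∀ p ∈ sphere z δ, 0 < φ p - h p := by
    intro p hp
    by_cases hpc : p ∈ closedBall c r
    · have h1 := haφ p ⟨hp, hpc⟩
      have h2 : h p < ε * (1 - 0) := by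
        refine mul_lt_mul_of_pos_left ?_ hεpos
        have h3 : Real.exp (-k * ‖p - c‖ ^ 2) ≤ 1 := by
          rw [Real.exp_le_one_iff]
          nlinarith [sq_nonneg ‖p - c‖]
        linarith [Real.exp_pos (-k * r ^ 2)]
      linarith
    · have h1 := hpos p (hball (sphere_subset_closedBall hp)).1
      have h2 : h p < 0 := by
        refine mul_neg_of_pos_of_neg hεpos (sub_neg.2 (Real.exp_lt_exp.2 ?_))
        rw [mem_closedBall, dist_eq_norm, not_le] at hpc
        have : r ^ 2 < ‖p - c‖ ^ 2 := by gcongr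
        nlinarith
      linarith
  have hhz : h z = 0 := by
    rw [hh, barrier, hzc, norm_neg, ← hr, sub_self, mul_zero]
  obtain ⟨x, hx, hxmin⟩ := (isCompact_closedBall z δ).exists_isMinOn
    ⟨z, mem_closedBall_self hδ.le⟩ (hφcont.sub (contDiff_barrier ε k r c).continuous.continuousOn)
  have hxle : φ x - h x ≤ 0 := by
    have := hxmin (mem_closedBall_self hδ.le)
    change φ x - h x ≤ φ z - h z at this
    rwa [hφz, hhz, sub_zero] at this
  have hxball : x ∈ ball z δ := by
    rcases (mem_closedBall.1 hx).lt_or_eq with h1 | h1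
    · exact h1
    · exact absurd (hsphere x h1) hxle.not_gt
  have hloc : IsLocalMin (fun p => φ p - h p) x :=
    hxmin.isLocalMin (closedBall_mem_nhds_of_mem hxball)
  obtain ⟨hxU, hxK, hxS, hxQ⟩ := hball hx
  obtain ⟨hgrad, hhess⟩ := fderiv_eq_and_fderiv_fderiv_le_of_isLocalMin_sub hloc (hφ x hxU)
    (contDiff_barrier ε k r c).contDiffAt
  set e : ℝ := 2 * k * ε * Real.exp (-k * ‖x - c‖ ^ 2) with he
  have hepos : 0 < e := by positivity
  have hlow : e * (2 * k * S x - ∑ j, ‖X j x‖ ^ 2)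
      ≤ ∑ j, fderiv ℝ (fderiv ℝ φ) x (X j x) (X j x) := by
    refine le_trans (le_of_eq ?_) (Finset.sum_le_sum fun j _ => hhess (X j x))
    simp only [hh, fderiv_fderiv_barrier_apply, hS]
    rw [← Finset.mul_sum, Finset.sum_sub_distrib, ← Finset.mul_sum]
  -- As `∇φ = ∇h` at `x`, the gradient term carries the same factor `e` as the Hessian bound, and
  -- `e` cancels.
  have hup : K * ‖fderiv ℝ φ x‖ ≤ e * (|K| * ‖x - c‖) := by
    have h1 := norm_fderiv_barrier_le hεpos.le hkpos.le r c x
    rw [← hh, ← he, ← hgrad] at h1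
    calc K * ‖fderiv ℝ φ x‖ ≤ |K| * ‖fderiv ℝ φ x‖ := by gcongr; exact le_abs_self K
      _ ≤ |K| * (e * ‖x - c‖) := by gcongr
      _ = e * (|K| * ‖x - c‖) := by ring
  have hfin : 2 * k * S x - ∑ j, ‖X j x‖ ^ 2 ≤ |K| * ‖x - c‖ :=
    le_of_mul_le_mul_left (hlow.trans (hxK.trans hup)) hepos
  have hkR : 2 * k * s₀ = R := by rw [hk]; field_simp
  have : 2 * k * s₀ < 2 * k * S x := by gcongr
  simp only [hQ] at hxQ
  linarith

end HopfLemma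
end HorizontalCurvature

namespace HorizontalCurvature

/-! ### Linearising the curvature and concluding. -/

section Curvature

open Metric Set Filter Topology

variable {m : ℕ}

/-- The divergence of `G / |G|` at a point where `G` has value `p` and derivative `A`. -/
noncomputable def normalizedTrace (p : E m) (A : E m →L[ℝ] E m) : ℝ :=
  ‖p‖⁻¹ * (∑ i, (A (EuclideanSpace.single i 1)) i - (‖p‖ ^ 2)⁻¹ * inner ℝ p (A p))

theorem normalizedTrace_sub (p : E m) (A B : E m →L[ℝ] E m) :
    normalizedTrace p (A - B) = normalizedTrace p A - normalizedTrace p B := by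
  simp only [normalizedTrace, sub_apply, inner_sub_right, PiLp.sub_apply,
    Finset.sum_sub_distrib]
  ring

theorem sum_single_eq_trace (A : E m →L[ℝ] E m) :
    ∑ i, (A (EuclideanSpace.single i 1)) i = LinearMap.trace ℝ (E m) A := by
  rw [LinearMap.trace_eq_sum_inner _ (EuclideanSpace.basisFun (Fin m) ℝ)]
  simp [EuclideanSpace.inner_single_left]

/-- Adjoining `p / ‖p‖` completes the frame to an orthonormal basis; the sum is the full trace minus
the entry in that direction. -/
theorem sum_inner_frame (hm : 1 ≤ m) {p : E m} (hp : p ≠ 0) {X : Fin (m - 1) → E m}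
    (hX : Orthonormal ℝ X) (hXp : ∀ i, inner ℝ p (X i) = 0) (A : E m →L[ℝ] E m) :
    ∑ i, inner ℝ (A (X i)) (X i) = ‖p‖ * normalizedTrace p A := by
  have hp' : ‖p‖ ≠ 0 := norm_ne_zero_iff.2 hp
  set f : Option (Fin (m - 1)) → E m := fun o => o.elim (‖p‖⁻¹ • p) X with hf
  have hfo : Orthonormal ℝ f := by
    refine ⟨?_, ?_⟩
    · rintro (_ | i)
      · simp [hf, norm_smul, hp']
      · exact hX.1 i
    · rintro (_ | i) (_ | j) hij
      · exact absurd rfl hij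
      · simp [hf, real_inner_smul_left, hXp]
      · simp [hf, real_inner_smul_right, real_inner_comm, hXp]
      · exact hX.2 fun h => hij (congrArg some h)
  obtain ⟨b, hb⟩ := Orthonormal.exists_orthonormalBasis_extension_of_card_eq (𝕜 := ℝ)
    (ι := Option (Fin (m - 1))) (E := E m) (v := f) (s := univ)
    (by simp; omega) (hfo.comp _ Subtype.val_injective)
  have hb' : ∀ o, b o = f o := fun o => hb o (mem_univ o)
  have htr := LinearMap.trace_eq_sum_inner (A : E m →ₗ[ℝ] E m) b
  rw [← sum_single_eq_trace, Fintype.sum_option] at htr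
  simp only [hb', hf, Option.elim_none, Option.elim_some, ContinuousLinearMap.coe_coe, map_smul,
    real_inner_smul_left, real_inner_smul_right] at htr
  rw [normalizedTrace, htr, ← mul_assoc, mul_inv_cancel₀ hp', one_mul]
  simp only [real_inner_comm]
  ring_nf

theorem divergence_normalized {G : E m → E m} {A : E m →L[ℝ] E m} {x : E m}
    (hG : HasFDerivAt G A x) (hx : G x ≠ 0) :
    divergence (fun y => ‖G y‖⁻¹ • G y) x = normalizedTrace (G x) A := by
  have hn : ‖G x‖ ≠ 0 := norm_ne_zero_iff.2 hx
  have h1 : HasFDerivAt (fun y => √(‖G y‖ ^ 2)) _ x := hG.norm_sq.sqrt (by positivity)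
  simp only [Real.sqrt_sq (norm_nonneg _)] at h1
  have h2 : HasFDerivAt (fun y => ‖G y‖⁻¹) _ x := (hasDerivAt_inv hn).comp_hasFDerivAt x h1
  have h3 := h2.smul hG
  have h4 : fderiv ℝ (fun y => ‖G y‖⁻¹ • G y) x = _ := h3.fderiv
  have hval : ∀ i : Fin m, (fderiv ℝ (fun y => ‖G y‖⁻¹ • G y) x (EuclideanSpace.single i 1)) i
      = ‖G x‖⁻¹ * (A (EuclideanSpace.single i 1)) i - ‖G x‖⁻¹ * ((‖G x‖ ^ 2)⁻¹ *
        inner ℝ (G x) (A ((G x i) • EuclideanSpace.single i 1))) := by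
    intro i
    rw [h4]
    simp [real_inner_smul_right]
    field_simp
    ring
  have hsum : ∑ i, (G x i) • EuclideanSpace.single i (1 : ℝ) = G x := by
    simpa using (EuclideanSpace.basisFun (Fin m) ℝ).sum_repr (G x)
  rw [divergence, Finset.sum_congr rfl fun i _ => hval i, Finset.sum_sub_distrib,
    ← Finset.mul_sum, ← Finset.mul_sum, ← Finset.mul_sum, ← inner_sum, ← map_sum, hsum,
    normalizedTrace, mul_sub]

theorem contDiffAt_normalizedTrace {p : E m} (hp : p ≠ 0) (A : E m →L[ℝ] E m) :
    ContDiffAt ℝ 1 (fun q : E m × (E m →L[ℝ] E m) => normalizedTrace q.1 q.2) (p, A) := by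
  have hp' : ‖p‖ ≠ 0 := norm_ne_zero_iff.2 hp
  have hfst : ContDiffAt ℝ 1 (fun q : E m × (E m →L[ℝ] E m) => q.1) (p, A) := contDiffAt_fst
  have hsnd : ContDiffAt ℝ 1 (fun q : E m × (E m →L[ℝ] E m) => q.2) (p, A) := contDiffAt_snd
  have hnorm := hfst.norm ℝ (by exact hp)
  unfold normalizedTrace
  refine (hnorm.inv hp').mul ((ContDiffAt.sum fun i _ => ?_).sub
    (((hnorm.pow 2).inv (pow_ne_zero 2 hp')).mul (hfst.inner ℝ (hsnd.clm_apply hfst))))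
  exact contDiffAt_euclidean.1 (hsnd.clm_apply contDiffAt_const) i

/-- `normalizedTrace` is `C^1` where its first argument is nonzero, hence locally Lipschitz. With
the second argument shared, only the difference of the first ones counts. -/
theorem exists_normalizedTrace_lipschitz {p q : E m → E m} {A : E m → E m →L[ℝ] E m} {z : E m}
    (hp : ContinuousAt p z) (hq : ContinuousAt q z) (hA : ContinuousAt A z) (hpq : p z = q z)
    (hz : p z ≠ 0) : ∃ L : ℝ, 0 ≤ L ∧ ∀ᶠ x in 𝓝 z,
      normalizedTrace (p x) (A x) - normalizedTrace (q x) (A x) ≤ L * ‖p x - q x‖ := by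
  obtain ⟨L, S, hS, hL⟩ := (contDiffAt_normalizedTrace hz (A z)).exists_lipschitzOnWith
  refine ⟨L, L.2, ?_⟩
  have h1 : ContinuousAt (fun x => (p x, A x)) z := hp.prodMk hA
  have h2 : ContinuousAt (fun x => (q x, A x)) z := hq.prodMk hA
  filter_upwards [h1.preimage_mem_nhds hS, h2.preimage_mem_nhds (by rw [← hpq]; exact hS)]
    with x hx1 hx2
  have h := hL.norm_sub_le hx1 hx2
  have h3 : ‖(p x, A x) - (q x, A x)‖ = ‖p x - q x‖ := by simp [Prod.norm_def]
  rw [h3] at h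
  exact (le_abs_self _).trans h

theorem contDiffAt_gradient {u : E m → ℝ} {x : E m} (hu : ContDiffAt ℝ 2 u x) :
    ContDiffAt ℝ 1 (gradient u) x := by
  refine contDiffAt_euclidean.2 fun i => ?_
  have h : (fun y => gradient u y i) = fun y => fderiv ℝ u y (EuclideanSpace.single i 1) := by
    funext y
    rw [← inner_gradient_left, EuclideanSpace.inner_single_right]
    simp
  rw [h]
  exact (hu.fderiv_right (m := 1) (by norm_num)).clm_apply contDiffAt_const

theorem norm_gradient_sub (u v : E m → ℝ) (x : E m) :
    ‖gradient v x - gradient u x‖ = ‖fderiv ℝ v x - fderiv ℝ u x‖ := by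
  rw [gradient, gradient, ← map_sub, LinearIsometryEquiv.norm_map]

theorem inner_fderiv_gradient {u : E m → ℝ} {x : E m} (hu : ContDiffAt ℝ 2 u x) (w w' : E m) :
    inner ℝ (fderiv ℝ (gradient u) x w) w' = fderiv ℝ (fderiv ℝ u) x w w' := by
  have h1 : HasFDerivAt (gradient u) (fderiv ℝ (gradient u) x) x :=
    ((contDiffAt_gradient hu).differentiableAt one_ne_zero).hasFDerivAt
  have h2 : HasFDerivAt (fderiv ℝ u) (fderiv ℝ (fderiv ℝ u) x) x :=
    ((hu.fderiv_right (m := 1) (by norm_num)).differentiableAt one_ne_zero).hasFDerivAt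
  have h3 := h1.inner ℝ (hasFDerivAt_const w' x)
  have h4 := h2.clm_apply (hasFDerivAt_const w' x)
  simp only [inner_gradient_left] at h3
  have h5 := congrArg (fun L => L w) (h3.unique h4)
  simpa using h5

/-- Where `v - u` vanishes, its horizontal Hessian trace is controlled by its gradient. -/
theorem exists_sum_hessian_le (hm : 1 ≤ m) {U : Set (E m)} (hU : IsOpen U) {F : E m → E m}
    (hF : ContDiffOn ℝ 1 F U) {u v : E m → ℝ} (hu : ContDiffOn ℝ 2 u U) (hv : ContDiffOn ℝ 2 v U)
    (hnu : ∀ x ∈ U, Nonsingular F u x) (hnv : ∀ x ∈ U, Nonsingular F v x)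
    (hH : ∀ x ∈ U, horizontalMeanCurvature F v x ≤ horizontalMeanCurvature F u x)
    {w : E m → ℝ} (hw : w = u ∨ w = v) {X : Fin (m - 1) → E m → E m}
    (hX : IsOrthonormalFramePerp U (horizontalNormal F w) X) {z : E m} (hz : z ∈ U)
    (hgrad : gradient v z = gradient u z) :
    ∃ K : ℝ, ∀ᶠ x in 𝓝 z, ∑ i, fderiv ℝ (fderiv ℝ fun y => v y - u y) x (X i x) (X i x)
      ≤ K * ‖fderiv ℝ (fun y => v y - u y) x‖ := by
  have huat : ∀ x ∈ U, ContDiffAt ℝ 2 u x := fun x hx => hu.contDiffAt (hU.mem_nhds hx)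
  have hvat : ∀ x ∈ U, ContDiffAt ℝ 2 v x := fun x hx => hv.contDiffAt (hU.mem_nhds hx)
  set G : (E m → ℝ) → E m → E m := fun f x => gradient f x + F x with hG
  have hGd : ∀ f : E m → ℝ, ∀ x ∈ U, ContDiffAt ℝ 2 f x → ContDiffAt ℝ 1 (G f) x :=
    fun f x hx hf => (contDiffAt_gradient hf).add (hF.contDiffAt (hU.mem_nhds hx))
  have hGc : ∀ f : E m → ℝ, ContDiffAt ℝ 2 f z → ContinuousAt (G f) z := fun f hf =>
    (hGd f z hz hf).continuousAt
  have hAc : ∀ f : E m → ℝ, ContDiffAt ℝ 2 f z → ContinuousAt (fderiv ℝ (G f)) z := fun f hf =>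
    ((hGd f z hz hf).fderiv_right (m := 0) (by norm_num)).continuousAt
  have hGz : G u z = G v z := by simp only [hG, hgrad]
  have hcurv : ∀ f : E m → ℝ, ∀ x ∈ U, ContDiffAt ℝ 2 f x → Nonsingular F f x →
      horizontalMeanCurvature F f x = normalizedTrace (G f x) (fderiv ℝ (G f) x) :=
    fun f x hx hf hn =>
      divergence_normalized ((hGd f x hx hf).differentiableAt one_ne_zero).hasFDerivAt hn
  have hwat : ∀ x ∈ U, ContDiffAt ℝ 2 w x := by rcases hw with rfl | rfl <;> assumption
  have hnw : ∀ x ∈ U, G w x ≠ 0 := by rcases hw with rfl | rfl <;> assumption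
  -- The frame belongs to `w`, so the base point is `G w`. One of the two terms is then the
  -- curvature of `w` itself; the other is moved to its own base point at Lipschitz cost, with
  -- derivative `A_v` if `w = u` and `A_u` if `w = v`.
  obtain ⟨L, hL0, hL⟩ : ∃ L : ℝ, 0 ≤ L ∧ ∀ᶠ x in 𝓝 z,
      normalizedTrace (G w x) (fderiv ℝ (G v) x - fderiv ℝ (G u) x) ≤ L * ‖G u x - G v x‖ := by
    rcases hw with rfl | rfl
    · obtain ⟨L, hL0, hL⟩ := exists_normalizedTrace_lipschitz (hGc w (huat z hz))
        (hGc v (hvat z hz)) (hAc v (hvat z hz)) hGz (hnu z hz)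
      refine ⟨L, hL0, ?_⟩
      filter_upwards [hL, hU.eventually_mem hz] with x hx hxU
      have := hH x hxU
      rw [hcurv w x hxU (huat x hxU) (hnu x hxU), hcurv v x hxU (hvat x hxU) (hnv x hxU)] at this
      rw [normalizedTrace_sub]
      linarith
    · obtain ⟨L, hL0, hL⟩ := exists_normalizedTrace_lipschitz (hGc u (huat z hz))
        (hGc w (hvat z hz)) (hAc u (huat z hz)) hGz (hnu z hz)
      refine ⟨L, hL0, ?_⟩
      filter_upwards [hL, hU.eventually_mem hz] with x hx hxU
      have := hH x hxU
      rw [hcurv u x hxU (huat x hxU) (hnu x hxU), hcurv w x hxU (hvat x hxU) (hnv x hxU)] at this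
      rw [normalizedTrace_sub]
      linarith
  -- The frame sum carries the factor `‖G w x‖`, which is below `‖G w z‖ + 1` near `z`.
  refine ⟨(‖G w z‖ + 1) * L, ?_⟩
  filter_upwards [hL, hU.eventually_mem hz,
    (hGc w (hwat z hz)).norm.eventually (gt_mem_nhds (lt_add_one _))] with x hx hxU hxG
  have hdu := (huat x hxU).differentiableAt two_ne_zero
  have hdv := (hvat x hxU).differentiableAt two_ne_zero
  have hgu := (contDiffAt_gradient (huat x hxU)).differentiableAt one_ne_zero
  have hgv := (contDiffAt_gradient (hvat x hxU)).differentiableAt one_ne_zero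
  have hFx := (hF.contDiffAt (hU.mem_nhds hxU)).differentiableAt one_ne_zero
  have hnorm : ‖fderiv ℝ (fun y => v y - u y) x‖ = ‖G u x - G v x‖ := by
    rw [fderiv_fun_sub hdv hdu, ← norm_gradient_sub, norm_sub_rev]
    simp only [hG, add_sub_add_right_eq_sub]
  have hdd : fderiv ℝ (fderiv ℝ fun y => v y - u y) x
      = fderiv ℝ (fderiv ℝ v) x - fderiv ℝ (fderiv ℝ u) x := by
    have hev : fderiv ℝ (fun y => v y - u y) =ᶠ[𝓝 x] fun y => fderiv ℝ v y - fderiv ℝ u y := by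
      filter_upwards [hU.eventually_mem hxU] with y hy
      exact fderiv_fun_sub ((hvat y hy).differentiableAt two_ne_zero)
        ((huat y hy).differentiableAt two_ne_zero)
    rw [hev.fderiv_eq]
    exact fderiv_fun_sub
      (((hvat x hxU).fderiv_right (m := 1) (by norm_num)).differentiableAt one_ne_zero)
      (((huat x hxU).fderiv_right (m := 1) (by norm_num)).differentiableAt one_ne_zero)
  have hhess : ∀ a : E m, fderiv ℝ (fderiv ℝ fun y => v y - u y) x a a
      = inner ℝ ((fderiv ℝ (G v) x - fderiv ℝ (G u) x) a) a := by
    intro a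
    rw [hdd, show fderiv ℝ (G v) x = fderiv ℝ (gradient v) x + fderiv ℝ F x from
        fderiv_fun_add hgv hFx,
      show fderiv ℝ (G u) x = fderiv ℝ (gradient u) x + fderiv ℝ F x from fderiv_fun_add hgu hFx,
      add_sub_add_right_eq_sub, sub_apply, sub_apply, sub_apply,
      inner_sub_left, inner_fderiv_gradient (hvat x hxU), inner_fderiv_gradient (huat x hxU)]
  obtain ⟨hXo, hXs⟩ := hX.2 x hxU
  have hperp : ∀ i, inner ℝ (G w x) (X i x) = 0 := by
    intro i
    have h1 : X i x ∈ (Submodule.span ℝ {horizontalNormal F w x})ᗮ :=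
      hXs ▸ Submodule.subset_span ⟨i, rfl⟩
    have h2 := Submodule.mem_orthogonal_singleton_iff_inner_right.1 h1
    rw [horizontalNormal, real_inner_smul_left] at h2
    exact (mul_eq_zero.1 h2).resolve_left (inv_ne_zero (norm_ne_zero_iff.2 (hnw x hxU)))
  simp only [hhess]
  rw [sum_inner_frame hm (hnw x hxU) hXo hperp, hnorm]
  have hr : 0 ≤ L * ‖G u x - G v x‖ := by positivity
  calc _ ≤ ‖G w x‖ * (L * ‖G u x - G v x‖) := by gcongr
    _ ≤ (‖G w z‖ + 1) * (L * ‖G u x - G v x‖) := by gcongr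
    _ = _ := by ring

theorem eq_of_frame (hm : 1 ≤ m) {U : Set (E m)} (hU : IsOpen U) (hUc : IsPreconnected U)
    {F : E m → E m} (hF : ContDiffOn ℝ 1 F U) {u v : E m → ℝ} (hu : ContDiffOn ℝ 2 u U)
    (hv : ContDiffOn ℝ 2 v U) (hnu : ∀ x ∈ U, Nonsingular F u x)
    (hnv : ∀ x ∈ U, Nonsingular F v x)
    (hH : ∀ x ∈ U, horizontalMeanCurvature F v x ≤ horizontalMeanCurvature F u x)
    (hvu : ∀ x ∈ U, u x ≤ v x) {p₀ : E m} (hp₀ : p₀ ∈ U) (heq : v p₀ = u p₀)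
    {w : E m → ℝ} (hw : w = u ∨ w = v) (hframe : HasFullRankNormalFrame U F w) :
    ∀ x ∈ U, v x = u x := by
  obtain ⟨X, hX, hr⟩ := hframe
  have hφ : ContDiffOn ℝ 2 (fun y => v y - u y) U := hv.sub hu
  have hφat : ∀ x ∈ U, ContDiffAt ℝ 2 (fun y => v y - u y) x := fun x hx =>
    hφ.contDiffAt (hU.mem_nhds hx)
  -- The zero set is closed only relative to `U`; `C` is a closed subset of the whole space with the
  -- same trace on `U`.
  obtain ⟨C, hC, hCU⟩ := continuousOn_iff_isClosed.1 hφ.continuousOn {0} isClosed_singleton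
  have hmem : ∀ x ∈ U, x ∈ C ↔ v x - u x = 0 := by
    intro x hx
    have := Set.ext_iff.1 hCU x
    simpa [hx, iff_comm] using this
  have htan := isTangentTo_zeroSet hU hφat (fun x hx => sub_nonneg.2 (hvu x hx))
    (fun i => (hX.1 i).continuousOn) (fun z hz hz0 => exists_sum_hessian_le hm hU hF hu hv hnu hnv
      hH hw hX hz ?_) hmem
  · have hsub := subset_of_isTangentTo_of_lieRank hU hUc hC htan hr
      ⟨p₀, hp₀, (hmem p₀ hp₀).2 (sub_eq_zero.2 heq)⟩
    exact fun x hx => sub_eq_zero.1 ((hmem x hx).1 (hsub hx))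
  -- A zero of `φ ≥ 0` is a minimum, which gives the equality of gradients there.
  · have hmin : IsLocalMin (fun y => v y - u y) z := by
      filter_upwards [hU.eventually_mem hz] with y hy
      simp only [hz0]
      exact sub_nonneg.2 (hvu y hy)
    have h0 := hmin.fderiv_eq_zero
    rw [fderiv_fun_sub ((hv.contDiffAt (hU.mem_nhds hz)).differentiableAt two_ne_zero)
      ((hu.contDiffAt (hU.mem_nhds hz)).differentiableAt two_ne_zero)] at h0
    rw [gradient, gradient, sub_eq_zero.1 h0]

end Curvature
end HorizontalCurvature

theorem theoremF (m : ℕ) (hm : 3 ≤ m)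
    (U : Set (EuclideanSpace ℝ (Fin m))) (hUo : IsOpen U) (hUc : IsConnected U)
    (F : EuclideanSpace ℝ (Fin m) → EuclideanSpace ℝ (Fin m)) (hF : ContDiffOn ℝ 1 F U)
    (u v : EuclideanSpace ℝ (Fin m) → ℝ)
    (hu : ContDiffOn ℝ 2 u U) (hv : ContDiffOn ℝ 2 v U)
    (hnu : ∀ x ∈ U, HorizontalCurvature.Nonsingular F u x)
    (hnv : ∀ x ∈ U, HorizontalCurvature.Nonsingular F v x)
    (hH : ∀ x ∈ U, HorizontalCurvature.horizontalMeanCurvature F v x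
      ≤ HorizontalCurvature.horizontalMeanCurvature F u x)
    (hvu : ∀ x ∈ U, u x ≤ v x)
    (p₀ : EuclideanSpace ℝ (Fin m)) (hp₀ : p₀ ∈ U) (heq : v p₀ = u p₀)
    (hframe : HorizontalCurvature.HasFullRankNormalFrame U F u ∨
      HorizontalCurvature.HasFullRankNormalFrame U F v) :
    ∀ x ∈ U, v x = u x := by
  have hm1 : 1 ≤ m := by omega
  rcases hframe with h | h
  · exact HorizontalCurvature.eq_of_frame hm1 hUo hUc.isPreconnected hF hu hv hnu hnv hH hvu hp₀
      heq (Or.inl rfl) h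
  · exact HorizontalCurvature.eq_of_frame hm1 hUo hUc.isPreconnected hF hu hv hnu hnv hH hvu hp₀
      heq (Or.inr rfl) h
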